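/- Let $G$ be a finite simple chordal graph (every cycle of length at least $4$ has a chord). Let $d$ be the largest cardinality of a clique of $G$, let $c_i$ be the number of cliques of $G$ with $i$ vertices ($1\le i\le d$), and let the $b$-vector $(b_1,\dots,b_d)$ of $G$ be defined by the polynomial identity $$\sum_{i=1}^{d} b_i (x+1)^{i-1}=\sum_{i=1}^{d} c_i x^{i-1}.$$ For $1\le i\le d$ let $d_i(G)$ be the minimum cardinality of a set $\mathcal D$ of $i$-cliques (cliques with exactly $i$ vertices) of $G$ such that every maximal clique of $G$ with at least $i$ vertices contains a member of $\mathcal D$. Let $\widetilde\kappa(G)$ be the maximum of $|C\cap C'|$ over all pairs of distinct maximal cliques $C\neq C'$ of $G$ (with $\widetilde\kappa(G)=0$ if $G$ is complete, so that there is no such pair). Then: 1. $b_i\le d_i(G)$ for every $i$ with $1\le i\le d$; 2. $b_i=d_i(G)$ for every $i$ with $\widetilde\kappa(G)<i\le d$; 3. $b_i\le b_j$ for all $i,j$ with $\widetilde\kappa(G)<j\le i\le d$. -/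

import Mathlib

open Polynomial

namespace SimpleGraph

variable {V : Type*}

/-- A graph is chordal if every cycle of length at least `4` has a chord: an edge of the graph
joining two vertices of the cycle which is not an edge of the cycle. -/
def IsChordal (G : SimpleGraph V) : Prop :=
  ∀ (v : V) (w : G.Walk v v), w.IsCycle → 4 ≤ w.length →
    ∃ x ∈ w.support, ∃ y ∈ w.support, G.Adj x y ∧ s(x, y) ∉ w.edges

/-- `M` is a maximal clique: a clique not contained in any other clique. -/
def IsMaxlClique (G : SimpleGraph V) (M : Finset V) : Prop :=
  Maximal (fun s : Finset V => G.IsClique (s : Set V)) M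

/-- The entry `c_i` of the clique vector: the number of cliques with `i` vertices. -/
noncomputable def cliqueVec (G : SimpleGraph V) (i : ℕ) : ℕ :=
  (G.cliqueSet i).ncard

/-- The polynomial `∑_{i=1}^d c_i x^{i-1}`, where `d` is the clique number. -/
noncomputable def cliquePoly (G : SimpleGraph V) : ℤ[X] :=
  ∑ i ∈ Finset.Icc 1 G.cliqueNum, C (G.cliqueVec i : ℤ) * X ^ (i - 1)

/-- The entry `b_i` (`1 ≤ i ≤ d`) of the `b`-vector: the coefficient of `(x + 1)^{i-1}` in the
expansion of `∑_{i=1}^d c_i x^{i-1}` in powers of `x + 1`. The lemmas `sum_bVec` and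
`eq_bVec_of_sum_eq` say that `(b_1, …, b_d)` is the unique vector with
`∑_{i=1}^d b_i (x + 1)^{i-1} = ∑_{i=1}^d c_i x^{i-1}`. -/
noncomputable def bVec (G : SimpleGraph V) (i : ℕ) : ℤ :=
  (G.cliquePoly.comp (X - 1)).coeff (i - 1)

theorem sum_Icc_comp (f : ℕ → ℤ) (d : ℕ) (q : ℤ[X]) :
    (∑ i ∈ Finset.Icc 1 d, C (f i) * X ^ (i - 1)).comp q
      = ∑ i ∈ Finset.Icc 1 d, C (f i) * q ^ (i - 1) := by
  simp only [sum_comp, mul_comp, C_comp, X_pow_comp]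

theorem coeff_sum_Icc (f : ℕ → ℤ) (d k : ℕ) :
    (∑ i ∈ Finset.Icc 1 d, C (f i) * X ^ (i - 1) : ℤ[X]).coeff k
      = if k < d then f (k + 1) else 0 := by
  simp only [finsetSum_coeff, coeff_C_mul, coeff_X_pow, mul_ite, mul_one, mul_zero]
  split_ifs with h
  · rw [Finset.sum_eq_single (k + 1)]
    · simp
    · intro b hb hne
      rw [Finset.mem_Icc] at hb
      exact if_neg (by omega)
    · intro hn
      exact absurd (Finset.mem_Icc.2 ⟨by omega, by omega⟩) hn
  · refine Finset.sum_eq_zero fun b hb => ?_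
    rw [Finset.mem_Icc] at hb
    exact if_neg (by omega)

/-- The defining equation of the `b`-vector. -/
theorem sum_bVec (G : SimpleGraph V) :
    ∑ i ∈ Finset.Icc 1 G.cliqueNum, C (G.bVec i) * (X + 1) ^ (i - 1)
      = ∑ i ∈ Finset.Icc 1 G.cliqueNum, C (G.cliqueVec i : ℤ) * X ^ (i - 1) := by
  have key : ∑ i ∈ Finset.Icc 1 G.cliqueNum, C (G.bVec i) * X ^ (i - 1)
      = G.cliquePoly.comp (X - 1) := by
    ext k
    rw [coeff_sum_Icc]
    split_ifs with h
    · simp [bVec]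
    · symm
      rw [cliquePoly, sum_Icc_comp, finsetSum_coeff]
      refine Finset.sum_eq_zero fun i hi => ?_
      rw [Finset.mem_Icc] at hi
      rw [coeff_C_mul, coeff_eq_zero_of_natDegree_lt, mul_zero]
      have h1 : (X - 1 : ℤ[X]).natDegree = 1 := natDegree_X_sub_C (1 : ℤ)
      have h2 := natDegree_pow_le (p := (X - 1 : ℤ[X])) (n := i - 1)
      rw [h1] at h2
      omega
  rw [← sum_Icc_comp, key, comp_assoc]
  simp [cliquePoly]

/-- The defining equation determines the entries `b_1, …, b_d`. -/
theorem eq_bVec_of_sum_eq (G : SimpleGraph V) (b : ℕ → ℤ)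
    (hb : ∑ i ∈ Finset.Icc 1 G.cliqueNum, C (b i) * (X + 1) ^ (i - 1)
      = ∑ i ∈ Finset.Icc 1 G.cliqueNum, C (G.cliqueVec i : ℤ) * X ^ (i - 1))
    (i : ℕ) (h1 : 1 ≤ i) (hi : i ≤ G.cliqueNum) : b i = G.bVec i := by
  rw [bVec, cliquePoly, ← hb, ← sum_Icc_comp, comp_assoc]
  have : ((X + 1 : ℤ[X]).comp (X - 1)) = X := by simp
  rw [this, comp_X, coeff_sum_Icc, if_pos (by omega), Nat.sub_add_cancel h1]

/-- `D` is a dominating `i`-clique of `G`: a set of `i`-cliques such that every maximal clique of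
order at least `i` contains a member of `D`. -/
def IsDominatingClique (G : SimpleGraph V) (i : ℕ) (D : Finset (Finset V)) : Prop :=
  (∀ K ∈ D, G.IsNClique i K) ∧
    ∀ M : Finset V, G.IsMaxlClique M → i ≤ M.card → ∃ K ∈ D, K ⊆ M

/-- `d_i(G)`: the minimum size of a dominating `i`-clique of `G`. -/
noncomputable def cliqueDomNum (G : SimpleGraph V) (i : ℕ) : ℕ :=
  sInf {n | ∃ D : Finset (Finset V), G.IsDominatingClique i D ∧ D.card = n}

/-- In a finite graph the set of all `i`-cliques is a dominating `i`-clique, so that the minimum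
in `cliqueDomNum` is over a nonempty set. -/
theorem exists_isDominatingClique [Finite V] (G : SimpleGraph V) (i : ℕ) :
    ∃ D : Finset (Finset V), G.IsDominatingClique i D := by
  classical
  have : Fintype V := Fintype.ofFinite V
  refine ⟨G.cliqueFinset i, fun K hK => (mem_cliqueFinset_iff).1 hK, fun M hM hi => ?_⟩
  obtain ⟨K, hKM, hK⟩ := Finset.exists_subset_card_eq hi
  exact ⟨K, mem_cliqueFinset_iff.2 ⟨hM.prop.subset (by exact_mod_cast hKM), hK⟩, hKM⟩

/-- `κ̃(G)`: the maximum size of the intersection of two distinct maximal cliques of `G`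
(`0` if `G` has only one maximal clique, that is, if `G` is complete). -/
noncomputable def kappaTilde [DecidableEq V] (G : SimpleGraph V) : ℕ :=
  sSup {n | ∃ K L : Finset V,
    G.IsMaxlClique K ∧ G.IsMaxlClique L ∧ K ≠ L ∧ (K ∩ L).card = n}

/-- In a finite graph the supremum in `kappaTilde` is over a bounded set. -/
theorem bddAbove_kappaTilde [Finite V] [DecidableEq V] (G : SimpleGraph V) :
    BddAbove {n | ∃ K L : Finset V,
      G.IsMaxlClique K ∧ G.IsMaxlClique L ∧ K ≠ L ∧ (K ∩ L).card = n} := by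
  have : Fintype V := Fintype.ofFinite V
  refine ⟨Fintype.card V, ?_⟩
  rintro n ⟨K, L, -, -, -, rfl⟩
  exact Finset.card_le_univ _

end SimpleGraph

/-!
Every vertex set `W` of a chordal graph contains a vertex whose neighbours in `W` form a clique
(`IsChordal.exists_simplicial_not_adj`, Dirac's lemma), so statements about chordal graphs can be
proved by adding simplicial vertices one at a time (`IsChordal.elimination_induction`). Adding a
simplicial vertex with `k` neighbours adds `(x + 1) ^ k` to the clique polynomial, because the new
cliques correspond to the sets of neighbours. Hence it raises `b_{k+1}` by one and leaves the other
entries of the `b`-vector unchanged (`bVecIn_insert`).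

Call two `i`-cliques linked if their union is a clique. The same induction shows that `b_i` is the
number of connected components of this relation. This is expressed through functions on `i`-cliques
that agree on linked ones: such a function has at most `b_i` values
(`IsChordal.card_image_le_bVecIn`), and some such function has `b_i` values
(`IsChordal.exists_isCliqueInvariant`).

A function of the second kind takes all of its values on any dominating set of `i`-cliques, whence
`b_i ≤ d_i`. For `i > κ̃` an `i`-clique lies in exactly one maximal clique, and sending it there is a
function of the first kind, so there are at most `b_i` maximal cliques with at least `i` vertices.
As one `i`-clique from each of these makes a dominating set, their number equals both `b_i` and
`d_i`; it visibly decreases with `i`.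
-/

namespace SimpleGraph

variable {V : Type*}

/-! ### Simplicial vertices of chordal graphs -/

/-- The graph on the same vertices as `G` whose edges are the edges of `G` with both endpoints
in `A`. -/
def restrictTo (G : SimpleGraph V) (A : Set V) : SimpleGraph V where
  Adj x y := G.Adj x y ∧ x ∈ A ∧ y ∈ A
  symm := ⟨fun _ _ h => ⟨h.1.symm, h.2.2, h.2.1⟩⟩
  loopless := ⟨fun _ h => h.1.ne rfl⟩

theorem restrictTo_le (G : SimpleGraph V) (A : Set V) : G.restrictTo A ≤ G :=
  fun _ _ h => h.1

theorem restrictTo_mono (G : SimpleGraph V) {A B : Set V} (h : A ⊆ B) :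
    G.restrictTo A ≤ G.restrictTo B :=
  fun _ _ hxy => ⟨hxy.1, h hxy.2.1, h hxy.2.2⟩

theorem mem_of_mem_support_restrictTo {G : SimpleGraph V} {A : Set V} {a b x : V}
    (p : (G.restrictTo A).Walk a b) (ha : a ∈ A) (hx : x ∈ p.support) : x ∈ A := by
  induction p with
  | nil => simp_all
  | cons h p ih =>
    rw [Walk.support_cons, List.mem_cons] at hx
    rcases hx with rfl | hx
    · exact ha
    · exact ih h.2.2 hx

/-- A shortest walk is an induced path: an edge joining two of its vertices would be a shortcut
unless it belongs to the walk. -/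
theorem Walk.mem_edges_of_length_eq_dist {H : SimpleGraph V} {a b x y : V} (p : H.Walk a b)
    (hp : p.length = H.dist a b) (hx : x ∈ p.support) (hy : y ∈ p.support) (h : H.Adj x y) :
    s(x, y) ∈ p.edges := by
  obtain ⟨m, rfl, hm⟩ := Walk.mem_support_iff_exists_getVert.1 hx
  obtain ⟨n, rfl, hn⟩ := Walk.mem_support_iff_exists_getVert.1 hy
  clear hx hy
  wlog hmn : m ≤ n generalizing m n
  · rw [Sym2.eq_swap]
    exact this n hn m hm h.symm (by omega)
  have hne : m ≠ n := by
    rintro rfl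
    exact h.ne rfl
  have hle := dist_le ((p.take m).append (Walk.cons h (p.drop n)))
  rw [Walk.length_append, Walk.length_cons, Walk.take_length, Walk.drop_length, ← hp] at hle
  obtain rfl : n = m + 1 := by omega
  exact p.mk_mem_edges_iff_exists.2 ⟨m, by omega, rfl⟩

/-- Two neighbours `a`, `b` of `u` in a chordal graph are adjacent if they are joined by a walk
whose interior avoids the closed neighbourhood of `u`: otherwise a shortest such walk, closed up
through `u`, would be a cycle without a chord. -/
theorem IsChordal.adj_of_reachable {G : SimpleGraph V} (hG : G.IsChordal) {A : Set V}
    {u a b c c' : V} (hA : ∀ x ∈ A, x ≠ u ∧ ¬ G.Adj u x) (ha : G.Adj u a) (hb : G.Adj u b)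
    (hab : a ≠ b) (hc : c ∈ A) (hc' : c' ∈ A) (hca : G.Adj c a) (hcb : G.Adj c' b)
    (hr : (G.restrictTo A).Reachable c c') : G.Adj a b := by
  by_contra hn
  set B : Set V := insert a (insert b A) with hB
  have haB : a ∈ B := by simp [hB]
  have hbB : b ∈ B := by simp [hB]
  have hAB : A ⊆ B := fun x hx => by simp [hB, hx]
  have huB : u ∉ B := by
    rintro (rfl | rfl | h)
    · exact ha.ne rfl
    · exact hb.ne rfl
    · exact (hA _ h).1 rfl
  have hr' : (G.restrictTo B).Reachable a b := by
    have h1 : (G.restrictTo B).Adj a c := ⟨hca.symm, haB, hAB hc⟩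
    have h2 : (G.restrictTo B).Adj c' b := ⟨hcb, hAB hc', hbB⟩
    exact h1.reachable.trans ((hr.mono (restrictTo_mono G hAB)).trans h2.reachable)
  obtain ⟨p, hp⟩ := hr'.exists_walk_length_eq_dist
  have hpB : ∀ x ∈ p.support, x ∈ B := fun x hx => mem_of_mem_support_restrictTo p haB hx
  have hlen : 2 ≤ p.length := by
    rcases hl : p.length with _ | _ | n
    · exact absurd (Walk.eq_of_length_eq_zero hl) hab
    · exact absurd (Walk.adj_of_length_eq_one hl).1 hn
    · omega
  set q := p.mapLe (restrictTo_le G B) with hq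
  have hqs : q.support = p.support := Walk.support_mapLe_eq_support _ _
  have hqe : q.edges = p.edges := Walk.edges_mapLe_eq_edges _ _
  have hqp : q.IsPath := (Walk.isPath_of_length_eq_dist p hp).mapLe _
  -- the cycle `u, a, …, b, u`
  set r := q.concat hb.symm with hr
  have hrs : r.support = p.support.concat u := by 
    rw [hr, Walk.support_concat, hqs, List.concat_eq_append]
  have hre : r.edges = p.edges.concat s(b, u) := by rw [hr, Walk.edges_concat, hqe]
  have hrp : r.IsPath := hqp.concat (by rw [hqs]; exact fun h => huB (hpB u h)) hb.symm
  have hcyc : (Walk.cons ha r).IsCycle := by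
    rw [Walk.cons_isCycle_iff]
    refine ⟨hrp, fun h => ?_⟩
    rw [hre, List.concat_eq_append, List.mem_append, List.mem_singleton] at h
    rcases h with h | h
    · exact huB (hpB u (p.fst_mem_support_of_mem_edges h))
    · rw [Sym2.eq_iff] at h
      rcases h with ⟨rfl, -⟩ | ⟨-, rfl⟩
      · exact hb.ne rfl
      · exact hab rfl
  have hnbr : ∀ y ∈ p.support, G.Adj u y → s(u, y) ∈ (Walk.cons ha r).edges := by
    intro y hy huy
    rw [Walk.edges_cons, hre]
    rcases hpB y hy with rfl | rfl | h
    · simp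
    · simp [Sym2.eq_swap]
    · exact absurd huy (hA y h).2
  have hsupp : ∀ x ∈ (Walk.cons ha r).support, x = u ∨ x ∈ p.support := by
    intro x hx
    rw [Walk.support_cons, hrs] at hx
    simpa [or_comm, or_assoc] using hx
  obtain ⟨x, hx, y, hy, hxy, he⟩ := hG u _ hcyc (by simp [hr, hq]; omega)
  apply he
  rcases hsupp x hx with rfl | hx' <;> rcases hsupp y hy with rfl | hy'
  · exact absurd rfl hxy.ne
  · exact hnbr y hy' hxy
  · rw [Sym2.eq_swap]
    exact hnbr x hx' hxy.symm
  · have := p.mem_edges_of_length_eq_dist hp hx' hy' ⟨hxy, hpB x hx', hpB y hy'⟩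
    rw [Walk.edges_cons, hre]
    simp [this]

/-- Dirac's lemma, in a form that carries the induction: if some vertex of `W` is not adjacent to
`u`, then the subgraph induced on `W` has a simplicial vertex not adjacent to `u`. -/
theorem IsChordal.exists_simplicial_not_adj {G : SimpleGraph V} (hG : G.IsChordal)
    (W : Finset V) : ∀ u ∈ W, (∃ w ∈ W, w ≠ u ∧ ¬ G.Adj u w) →
      ∃ z ∈ W, z ≠ u ∧ ¬ G.Adj u z ∧ G.IsClique {x | x ∈ W ∧ G.Adj z x} := by
  classical
  induction W using Finset.strongInduction with
  | H W ih =>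
  rintro u hu ⟨c₀, hc₀W, hc₀u, hc₀⟩
  set A : Set V := {x | x ∈ W ∧ x ≠ u ∧ ¬ G.Adj u x} with hA
  have hc₀A : c₀ ∈ A := ⟨hc₀W, hc₀u, hc₀⟩
  -- `C` is the component of `c₀` after removal of the closed neighbourhood of `u`, and `S` is the
  -- boundary of `C`, a clique that separates `C` from `u`
  set C : Finset V := W.filter fun x => (G.restrictTo A).Reachable c₀ x with hC
  set S : Finset V := W.filter fun x => x ∉ C ∧ ∃ c ∈ C, G.Adj c x with hS
  have hCA : ∀ x ∈ C, x ∈ A := by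
    intro x hx
    obtain ⟨p⟩ := (Finset.mem_filter.1 hx).2
    exact mem_of_mem_support_restrictTo p hc₀A p.end_mem_support
  have hSu : ∀ x ∈ S, G.Adj u x := by
    intro x hx
    obtain ⟨hxW, hxC, c, hc, hcx⟩ := Finset.mem_filter.1 hx
    by_contra hux
    have hxu : x ≠ u := by
      rintro rfl
      exact (hCA c hc).2.2 hcx.symm
    have hadj : (G.restrictTo A).Adj c x := ⟨hcx, hCA c hc, hxW, hxu, hux⟩
    exact hxC (Finset.mem_filter.2 ⟨hxW, (Finset.mem_filter.1 hc).2.trans hadj.reachable⟩)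
  have hSclique : ∀ a ∈ S, ∀ b ∈ S, a ≠ b → G.Adj a b := by
    intro a ha b hb hab
    obtain ⟨-, -, c, hc, hca⟩ := Finset.mem_filter.1 ha
    obtain ⟨-, -, c', hc', hcb⟩ := Finset.mem_filter.1 hb
    exact hG.adj_of_reachable (A := A) (fun x hx => hx.2) (hSu a ha) (hSu b hb) hab
      (hCA c hc) (hCA c' hc') hca hcb
      ((Finset.mem_filter.1 hc).2.symm.trans (Finset.mem_filter.1 hc').2)
  have hss : C ∪ S ⊂ W := by
    rw [Finset.ssubset_iff_of_subset
      (Finset.union_subset (Finset.filter_subset _ _) (Finset.filter_subset _ _))]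
    refine ⟨u, hu, fun h => ?_⟩
    rcases Finset.mem_union.1 h with h | h
    · exact (hCA u h).2.1 rfl
    · exact (hSu u h).ne rfl
  have hnbr : ∀ z ∈ C, ∀ x ∈ W, G.Adj z x → x ∈ C ∪ S := by
    intro z hz x hx hzx
    by_cases hxC : x ∈ C
    · exact Finset.mem_union_left _ hxC
    · exact Finset.mem_union_right _ (Finset.mem_filter.2 ⟨hx, hxC, z, hz, hzx⟩)
  have finish : ∀ z ∈ C, G.IsClique {x | x ∈ C ∪ S ∧ G.Adj z x} →
      ∃ z ∈ W, z ≠ u ∧ ¬ G.Adj u z ∧ G.IsClique {x | x ∈ W ∧ G.Adj z x} := by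
    intro z hz h
    obtain ⟨h1, h2, h3⟩ := hCA z hz
    have hsub : {x | x ∈ W ∧ G.Adj z x} ⊆ {x | x ∈ C ∪ S ∧ G.Adj z x} :=
      fun x hx => ⟨hnbr z hz x hx.1 hx.2, hx.2⟩
    exact ⟨z, h1, h2, h3, h.subset hsub⟩
  by_cases hs : ∃ s ∈ S, ∃ w ∈ C ∪ S, w ≠ s ∧ ¬ G.Adj s w
  · obtain ⟨s, hsS, hw⟩ := hs
    obtain ⟨z, hz, hzs, hsz, hcl⟩ := ih _ hss s (Finset.mem_union_right _ hsS) hw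
    rcases Finset.mem_union.1 hz with hz | hz
    · exact finish z hz hcl
    · exact absurd (hSclique s hsS z hz hzs.symm) hsz
  push Not at hs
  by_cases hc : ∃ c ∈ C, ∃ w ∈ C ∪ S, w ≠ c ∧ ¬ G.Adj c w
  · obtain ⟨c, hcC, hw⟩ := hc
    obtain ⟨z, hz, hzc, hcz, hcl⟩ := ih _ hss c (Finset.mem_union_left _ hcC) hw
    rcases Finset.mem_union.1 hz with hz | hz
    · exact finish z hz hcl
    · exact absurd (hs z hz c (Finset.mem_union_left _ hcC) hzc.symm).symm hcz
  push Not at hc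
  refine finish c₀ (Finset.mem_filter.2 ⟨hc₀W, Reachable.refl _⟩) ?_
  rintro x ⟨hx, -⟩ y ⟨hy, -⟩ hxy
  rcases Finset.mem_union.1 hx with h | h
  · exact hc x h y hy hxy.symm
  · exact hs x h y hy hxy.symm

theorem IsChordal.exists_simplicial {G : SimpleGraph V} (hG : G.IsChordal) {W : Finset V}
    (hW : W.Nonempty) : ∃ z ∈ W, G.IsClique {x | x ∈ W ∧ G.Adj z x} := by
  by_cases h : ∃ u ∈ W, ∃ w ∈ W, w ≠ u ∧ ¬ G.Adj u w
  · obtain ⟨u, hu, hw⟩ := h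
    obtain ⟨z, hz, -, -, hcl⟩ := hG.exists_simplicial_not_adj W u hu hw
    exact ⟨z, hz, hcl⟩
  · push Not at h
    obtain ⟨z, hz⟩ := hW
    exact ⟨z, hz, fun x hx y hy hxy => h x hx.1 y hy.1 hxy.symm⟩

/-- Induction along a perfect elimination ordering: a property of vertex sets of a chordal graph
holds if it holds for `∅` and is preserved when a vertex is added whose neighbours in the set form
a clique. -/
theorem IsChordal.elimination_induction [DecidableEq V] {G : SimpleGraph V} [DecidableRel G.Adj]
    (hG : G.IsChordal) {P : Finset V → Prop} (empty : P ∅)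
    (insert : ∀ (W : Finset V) (v : V), v ∉ W → G.IsClique (W.filter (G.Adj v) : Set V) →
      P W → P (insert v W)) (W : Finset V) : P W := by
  induction W using Finset.strongInduction with
  | H W ih =>
  rcases W.eq_empty_or_nonempty with rfl | hW
  · exact empty
  obtain ⟨z, hz, hcl⟩ := hG.exists_simplicial hW
  rw [← Finset.insert_erase hz]
  have hsub : (((W.erase z).filter (G.Adj z) : Finset V) : Set V) ⊆ {x | x ∈ W ∧ G.Adj z x} := by
    intro x hx
    rw [Finset.mem_coe, Finset.mem_filter] at hx
    exact ⟨Finset.mem_of_mem_erase hx.1, hx.2⟩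
  exact insert _ z (Finset.notMem_erase z W) (hcl.subset hsub) (ih _ (Finset.erase_ssubset hz))

/-! ### The clique polynomial under addition of a simplicial vertex -/

open Classical in
/-- The polynomial `∑ x ^ (|K| - 1)` over the nonempty cliques `K` of `G` contained in `W`. -/
noncomputable def cliquePolyIn (G : SimpleGraph V) (W : Finset V) : ℤ[X] :=
  ∑ K ∈ W.powerset.filter fun K : Finset V => K.Nonempty ∧ G.IsClique (K : Set V),
    X ^ (K.card - 1)

/-- The `i`-th entry (`1 ≤ i`) of the `b`-vector of the subgraph of `G` induced on `W`. -/
noncomputable def bVecIn (G : SimpleGraph V) (W : Finset V) (i : ℕ) : ℤ :=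
  ((G.cliquePolyIn W).comp (X - 1)).coeff (i - 1)

theorem cliquePolyIn_univ [Fintype V] (G : SimpleGraph V) :
    G.cliquePolyIn Finset.univ = G.cliquePoly := by
  classical
  rw [cliquePolyIn, cliquePoly,
    ← Finset.sum_fiberwise_of_maps_to (t := Finset.Icc 1 G.cliqueNum) (g := Finset.card)]
  · refine Finset.sum_congr rfl fun i hi => ?_
    rw [Finset.mem_Icc] at hi
    rw [Finset.sum_congr rfl (g := fun _ => (X : ℤ[X]) ^ (i - 1))
      (fun K hK => by rw [(Finset.mem_filter.1 hK).2]), Finset.sum_const, nsmul_eq_mul]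
    congr 1
    rw [cliqueVec, ← Set.ncard_coe_finset, map_natCast]
    congr 2
    ext K
    simp only [mem_cliqueSet_iff, isNClique_iff, Finset.coe_filter, Finset.mem_filter,
      Finset.mem_powerset, Finset.subset_univ, true_and, Set.mem_ofPred_eq]
    constructor
    · rintro ⟨⟨-, h1⟩, h2⟩
      exact ⟨h1, h2⟩
    · rintro ⟨h1, h2⟩
      exact ⟨⟨Finset.card_pos.1 (by omega), h1⟩, h2⟩
  · intro K hK
    obtain ⟨-, h1, h2⟩ := Finset.mem_filter.1 hK
    exact Finset.mem_Icc.2 ⟨h1.card_pos, IsClique.card_le_cliqueNum (tc := h2)⟩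

theorem bVecIn_univ [Fintype V] (G : SimpleGraph V) (i : ℕ) :
    G.bVecIn Finset.univ i = G.bVec i := by
  rw [bVecIn, cliquePolyIn_univ, bVec]

theorem bVecIn_empty (G : SimpleGraph V) (i : ℕ) : G.bVecIn ∅ i = 0 := by
  classical
  simp [bVecIn, cliquePolyIn, Finset.filter_singleton]

section

variable [DecidableEq V] {G : SimpleGraph V} [DecidableRel G.Adj] {W : Finset V} {v : V}

theorem isClique_insert_filter (hN : G.IsClique (W.filter (G.Adj v) : Set V)) :
    G.IsClique ((insert v (W.filter (G.Adj v)) : Finset V) : Set V) := by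
  rw [Finset.coe_insert]
  exact hN.insert fun b hb _ => (Finset.mem_filter.1 (Finset.mem_coe.1 hb)).2

/-- The cliques that contain the new vertex `v` are the sets `insert v T` with `T` a set of
neighbours of `v`. -/
theorem cliquePolyIn_insert (hv : v ∉ W) (hN : G.IsClique (W.filter (G.Adj v) : Set V)) :
    G.cliquePolyIn (insert v W) = G.cliquePolyIn W + (X + 1) ^ (W.filter (G.Adj v)).card := by
  classical
  rw [cliquePolyIn, cliquePolyIn, Finset.sum_filter, Finset.sum_powerset_insert hv,
    Finset.sum_filter]
  congr 1
  rw [← Finset.sum_pow_mul_eq_add_pow]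
  simp only [one_pow, mul_one]
  have hsub : (W.filter (G.Adj v)).powerset ⊆ W.powerset :=
    Finset.powerset_mono.2 (Finset.filter_subset _ _)
  symm
  refine (Finset.sum_congr rfl fun T hT => ?_).trans
    (Finset.sum_subset hsub fun T hT hT' => ?_)
  · have hT' := Finset.mem_powerset.1 hT
    rw [if_pos, Finset.card_insert_of_notMem
      (fun h => hv (Finset.mem_filter.1 (hT' h)).1), Nat.add_sub_cancel]
    exact ⟨Finset.insert_nonempty v T, (isClique_insert_filter hN).subset
      (Finset.coe_subset.2 (Finset.insert_subset_insert v hT'))⟩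
  · rw [if_neg]
    rintro ⟨-, h⟩
    refine hT' (Finset.mem_powerset.2 fun x hx => ?_)
    have hxW := Finset.mem_powerset.1 hT hx
    refine Finset.mem_filter.2 ⟨hxW, h (by simp) (by simp [hx]) ?_⟩
    rintro rfl
    exact hv hxW

theorem bVecIn_insert (hv : v ∉ W) (hN : G.IsClique (W.filter (G.Adj v) : Set V)) {i : ℕ}
    (hi : 1 ≤ i) : G.bVecIn (insert v W) i
      = G.bVecIn W i + if (W.filter (G.Adj v)).card + 1 = i then 1 else 0 := by
  rw [bVecIn, cliquePolyIn_insert hv hN, add_comp, coeff_add, bVecIn, pow_comp, add_comp, X_comp,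
    one_comp, sub_add_cancel, coeff_X_pow]
  congr 2
  exact propext ⟨fun h => by omega, fun h => by omega⟩

end

/-! ### Functions constant on the `i`-subsets of every clique -/

open Classical in
/-- The `i`-cliques of `G` contained in `W`. -/
noncomputable def cliquesIn (G : SimpleGraph V) (W : Finset V) (i : ℕ) : Finset (Finset V) :=
  (W.powersetCard i).filter fun K => G.IsClique (K : Set V)

theorem mem_cliquesIn {G : SimpleGraph V} {W K : Finset V} {i : ℕ} :
    K ∈ G.cliquesIn W i ↔ (K ⊆ W ∧ K.card = i) ∧ G.IsClique (K : Set V) := by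
  classical
  rw [cliquesIn, Finset.mem_filter, Finset.mem_powersetCard]

/-- `g` takes the same value on any two `i`-cliques in `W` whose union is a clique. Such a `g` is a
function on the connected components of the graph on the `i`-cliques in `W` in which two
`i`-cliques are joined when their union is a clique. -/
def IsCliqueInvariant (G : SimpleGraph V) (W : Finset V) (i : ℕ) {α : Type*}
    (g : Finset V → α) : Prop :=
  ∀ K ∈ G.cliquesIn W i, ∀ L ∈ G.cliquesIn W i, G.IsClique (K ∪ L : Set V) → g K = g L

section

variable {G : SimpleGraph V} {W : Finset V} {v : V} {i : ℕ}

theorem cliquesIn_mono {W' : Finset V} (h : W ⊆ W') : G.cliquesIn W i ⊆ G.cliquesIn W' i := by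
  intro K hK
  rw [mem_cliquesIn] at hK ⊢
  exact ⟨⟨hK.1.1.trans h, hK.1.2⟩, hK.2⟩

theorem IsCliqueInvariant.mono {W' : Finset V} {α : Type*} {g : Finset V → α}
    (hg : G.IsCliqueInvariant W' i g) (h : W ⊆ W') : G.IsCliqueInvariant W i g :=
  fun K hK L hL => hg K (cliquesIn_mono h hK) L (cliquesIn_mono h hL)

theorem mem_cliquesIn_of_subset_filter [DecidableRel G.Adj] {K : Finset V}
    (hK : K ⊆ W.filter (G.Adj v)) (hN : G.IsClique (W.filter (G.Adj v) : Set V))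
    (hc : K.card = i) : K ∈ G.cliquesIn W i :=
  mem_cliquesIn.2 ⟨⟨hK.trans (Finset.filter_subset _ _), hc⟩, hN.subset (Finset.coe_subset.2 hK)⟩

variable [DecidableEq V]

theorem mem_cliquesIn_of_notMem {K : Finset V} (hK : K ∈ G.cliquesIn (insert v W) i)
    (hvK : v ∉ K) : K ∈ G.cliquesIn W i := by
  rw [mem_cliquesIn] at hK ⊢
  exact ⟨⟨(Finset.subset_insert_iff_of_notMem hvK).1 hK.1.1, hK.1.2⟩, hK.2⟩

variable [DecidableRel G.Adj]

theorem subset_insert_filter {K : Finset V} (hK : K ⊆ insert v W) {Q : Set V}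
    (hQ : G.IsClique Q) (hKQ : (K : Set V) ⊆ Q) (hvQ : v ∈ Q) :
    K ⊆ insert v (W.filter (G.Adj v)) := by
  intro x hx
  by_cases hxv : x = v
  · simp [hxv]
  · have hxW := (Finset.mem_insert.1 (hK hx)).resolve_left hxv
    exact Finset.mem_insert_of_mem
      (Finset.mem_filter.2 ⟨hxW, hQ hvQ (hKQ hx) (Ne.symm hxv)⟩)

/-- An `i`-clique through a simplicial vertex `v` with at most `i - 1` neighbours is the closed
neighbourhood of `v`. -/
theorem eq_insert_filter {K : Finset V} (hK : K ∈ G.cliquesIn (insert v W) i) (hvK : v ∈ K)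
    (hi : (W.filter (G.Adj v)).card + 1 ≤ i) : K = insert v (W.filter (G.Adj v)) := by
  obtain ⟨⟨hKW, hc⟩, hcl⟩ := mem_cliquesIn.1 hK
  refine Finset.eq_of_subset_of_card_le
    (subset_insert_filter hKW hcl subset_rfl (Finset.mem_coe.2 hvK)) ?_
  exact (Finset.card_insert_le _ _).trans (by omega)

end

section

variable [DecidableEq V] {G : SimpleGraph V}

/-- An invariant function takes at most `b_i` values. A simplicial vertex with at least `i`
neighbours brings no new value, since its `i`-cliques are linked to those among the neighbours. -/
theorem IsChordal.card_image_le_bVecIn (hG : G.IsChordal) {α : Type*} [DecidableEq α]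
    {i : ℕ} (hi : 1 ≤ i) (W : Finset V) : ∀ {g : Finset V → α}, G.IsCliqueInvariant W i g →
      (((G.cliquesIn W i).image g).card : ℤ) ≤ G.bVecIn W i := by
  classical
  induction W using hG.elimination_induction with
  | empty =>
    intro g _
    have : G.cliquesIn ∅ i = ∅ := by
      rw [Finset.eq_empty_iff_forall_notMem]
      intro K hK
      obtain ⟨⟨h, hc⟩, -⟩ := mem_cliquesIn.1 hK
      rw [Finset.subset_empty.1 h, Finset.card_empty] at hc
      omega
    simp [this, bVecIn_empty]
  | insert W v hv hN ih =>
    intro g hg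
    have ih' := ih (hg.mono (Finset.subset_insert v W))
    rw [bVecIn_insert hv hN hi]
    rcases le_or_gt i (W.filter (G.Adj v)).card with hk | hk
    · rw [if_neg (by omega), add_zero]
      refine le_trans ?_ ih'
      obtain ⟨K₀, hK₀, hc₀⟩ := Finset.exists_subset_card_eq hk
      have hK₀W := mem_cliquesIn_of_subset_filter hK₀ hN hc₀
      refine Int.ofNat_le.2 (Finset.card_le_card fun y hy => ?_)
      obtain ⟨K, hK, rfl⟩ := Finset.mem_image.1 hy
      by_cases hvK : v ∈ K
      · refine Finset.mem_image.2 ⟨K₀, hK₀W, ?_⟩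
        obtain ⟨⟨hKW, -⟩, hcl⟩ := mem_cliquesIn.1 hK
        refine hg K₀ (cliquesIn_mono (Finset.subset_insert v W) hK₀W) K hK
          ((isClique_insert_filter hN).subset (Set.union_subset ?_ ?_))
        · exact Finset.coe_subset.2 (hK₀.trans (Finset.subset_insert _ _))
        · exact Finset.coe_subset.2
            (subset_insert_filter hKW hcl subset_rfl (Finset.mem_coe.2 hvK))
      · exact Finset.mem_image_of_mem g (mem_cliquesIn_of_notMem hK hvK)
    · split_ifs with hki
      · have hsub : (G.cliquesIn (insert v W) i).image g
            ⊆ insert (g (insert v (W.filter (G.Adj v)))) ((G.cliquesIn W i).image g) := by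
          intro y hy
          obtain ⟨K, hK, rfl⟩ := Finset.mem_image.1 hy
          by_cases hvK : v ∈ K
          · rw [← eq_insert_filter hK hvK (by omega)]
            exact Finset.mem_insert_self _ _
          · exact Finset.mem_insert_of_mem
              (Finset.mem_image_of_mem g (mem_cliquesIn_of_notMem hK hvK))
        have h1 := Finset.card_le_card hsub
        have h2 := Finset.card_insert_le (g (insert v (W.filter (G.Adj v))))
          ((G.cliquesIn W i).image g)
        omega
      · rw [add_zero]
        refine le_trans (Int.ofNat_le.2 (Finset.card_le_card (Finset.image_subset_image ?_))) ih'
        intro K hK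
        by_cases hvK : v ∈ K
        · have h1 := eq_insert_filter hK hvK (by omega)
          have h2 := (mem_cliquesIn.1 hK).1.2
          have h3 := Finset.card_insert_le v (W.filter (G.Adj v))
          rw [← h1] at h3
          omega
        · exact mem_cliquesIn_of_notMem hK hvK

/-- Some invariant function takes at least `b_i` values. A simplicial vertex with exactly `i - 1`
neighbours gives an `i`-clique linked to no earlier one, which may receive a new value. -/
theorem IsChordal.exists_isCliqueInvariant (hG : G.IsChordal) {i : ℕ} (hi : 1 ≤ i)
    (W : Finset V) : ∃ f : Finset V → ℕ, G.IsCliqueInvariant W i f ∧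
      G.bVecIn W i ≤ (((G.cliquesIn W i).image f).card : ℤ) := by
  classical
  induction W using hG.elimination_induction with
  | empty => exact ⟨fun _ => 0, fun _ _ _ _ _ => rfl, by simp [bVecIn_empty]⟩
  | insert W v hv hN ih =>
    obtain ⟨f, hf, hcard⟩ := ih
    have hvW : ∀ K ∈ G.cliquesIn W i, v ∉ K := fun K hK h => hv ((mem_cliquesIn.1 hK).1.1 h)
    -- It suffices to choose the value `a` taken on all the `i`-cliques through `v`.
    suffices h : ∃ a : ℕ,
        (∀ K ∈ G.cliquesIn (insert v W) i, v ∈ K → ∀ L ∈ G.cliquesIn W i,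
          G.IsClique (K ∪ L : Set V) → a = f L) ∧
        ((W.filter (G.Adj v)).card + 1 = i → a ∉ (G.cliquesIn W i).image f) by
      obtain ⟨a, ha, ha'⟩ := h
      set f' : Finset V → ℕ := fun K => if v ∈ K then a else f K with hf'
      have himg : (G.cliquesIn W i).image f = (G.cliquesIn W i).image f' :=
        Finset.image_congr fun K hK => by simp [hf', hvW K hK]
      have hsub : (G.cliquesIn W i).image f ⊆ (G.cliquesIn (insert v W) i).image f' := by
        rw [himg]
        exact Finset.image_subset_image (cliquesIn_mono (Finset.subset_insert v W))
      refine ⟨f', fun K hK L hL hKL => ?_, ?_⟩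
      · by_cases hvK : v ∈ K <;> by_cases hvL : v ∈ L
        · simp [hf', hvK, hvL]
        · simpa [hf', hvK, hvL] using ha K hK hvK L (mem_cliquesIn_of_notMem hL hvL) hKL
        · rw [Set.union_comm] at hKL
          simpa [hf', hvK, hvL] using
            (ha L hL hvL K (mem_cliquesIn_of_notMem hK hvK) hKL).symm
        · simpa [hf', hvK, hvL] using hf K (mem_cliquesIn_of_notMem hK hvK) L
            (mem_cliquesIn_of_notMem hL hvL) hKL
      · rw [bVecIn_insert hv hN hi]
        split_ifs with hki
        · have hmem : insert v (W.filter (G.Adj v)) ∈ G.cliquesIn (insert v W) i :=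
            mem_cliquesIn.2 ⟨⟨Finset.insert_subset_insert v (Finset.filter_subset _ _),
              by rw [Finset.card_insert_of_notMem
                (fun h => hv (Finset.mem_filter.1 h).1), hki]⟩, isClique_insert_filter hN⟩
          have hins : insert a ((G.cliquesIn W i).image f)
              ⊆ (G.cliquesIn (insert v W) i).image f' :=
            Finset.insert_subset (Finset.mem_image.2 ⟨_, hmem, by simp [hf']⟩) hsub
          have h1 := Finset.card_le_card hins
          rw [Finset.card_insert_of_notMem (ha' hki)] at h1
          omega
        · rw [add_zero]
          exact hcard.trans (Int.ofNat_le.2 (Finset.card_le_card hsub))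
    have hLN : ∀ K ∈ G.cliquesIn (insert v W) i, v ∈ K → ∀ L ∈ G.cliquesIn W i,
        G.IsClique (K ∪ L : Set V) → L ⊆ W.filter (G.Adj v) := by
      intro K hK hvK L hL hKL
      have hLW := (mem_cliquesIn.1 hL).1.1
      exact (Finset.subset_insert_iff_of_notMem (hvW L hL)).1 (subset_insert_filter
        (hLW.trans (Finset.subset_insert v W)) hKL Set.subset_union_right (Or.inl hvK))
    rcases le_or_gt i (W.filter (G.Adj v)).card with hk | hk
    · obtain ⟨K₀, hK₀, hc₀⟩ := Finset.exists_subset_card_eq hk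
      refine ⟨f K₀, fun K hK hvK L hL hKL => ?_, fun h => by omega⟩
      refine hf K₀ (mem_cliquesIn_of_subset_filter hK₀ hN hc₀) L hL (hN.subset ?_)
      exact Set.union_subset (Finset.coe_subset.2 hK₀)
        (Finset.coe_subset.2 (hLN K hK hvK L hL hKL))
    · obtain ⟨a, ha⟩ := Infinite.exists_notMem_finset ((G.cliquesIn W i).image f)
      refine ⟨a, fun K hK hvK L hL hKL => ?_, fun _ => ha⟩
      have h1 := Finset.card_le_card (hLN K hK hvK L hL hKL)
      have h2 := (mem_cliquesIn.1 hL).1.2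
      omega

end

/-! ### Dominating sets of cliques and maximal cliques -/

section

variable [Fintype V] {G : SimpleGraph V} {i : ℕ}

theorem IsClique.exists_isMaxlClique {K : Finset V} (hK : G.IsClique (K : Set V)) :
    ∃ M : Finset V, K ⊆ M ∧ G.IsMaxlClique M :=
  Finite.exists_le_maximal (p := fun s : Finset V => G.IsClique (s : Set V)) hK

/-- Every `i`-clique lies in a maximal clique, together with a member of the dominating set; so an
invariant function takes all of its values on the dominating set. -/
theorem IsChordal.bVec_le_card_of_isDominatingClique (hG : G.IsChordal) (hi : 1 ≤ i)
    {D : Finset (Finset V)} (hD : G.IsDominatingClique i D) : G.bVec i ≤ D.card := by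
  classical
  obtain ⟨f, hf, hcard⟩ := hG.exists_isCliqueInvariant hi Finset.univ
  rw [bVecIn_univ] at hcard
  refine hcard.trans (Int.ofNat_le.2
    ((Finset.card_le_card fun y hy => ?_).trans (Finset.card_image_le (s := D) (f := f))))
  obtain ⟨K, hK, rfl⟩ := Finset.mem_image.1 hy
  obtain ⟨⟨-, hc⟩, hcl⟩ := mem_cliquesIn.1 hK
  obtain ⟨M, hKM, hM⟩ := hcl.exists_isMaxlClique
  obtain ⟨L, hLD, hLM⟩ := hD.2 M hM (hc ▸ Finset.card_le_card hKM)
  have hL := hD.1 L hLD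
  refine Finset.mem_image.2 ⟨L, hLD, hf L
    (mem_cliquesIn.2 ⟨⟨Finset.subset_univ _, hL.card_eq⟩, hL.isClique⟩) K hK ?_⟩
  exact hM.prop.subset
    (Set.union_subset (Finset.coe_subset.2 hLM) (Finset.coe_subset.2 hKM))

theorem IsChordal.bVec_le_cliqueDomNum (hG : G.IsChordal) (hi : 1 ≤ i) :
    G.bVec i ≤ G.cliqueDomNum i := by
  obtain ⟨D, hD⟩ := G.exists_isDominatingClique i
  obtain ⟨D', hD', hc⟩ := Nat.sInf_mem (s := {n | ∃ D : Finset (Finset V),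
    G.IsDominatingClique i D ∧ D.card = n}) ⟨_, D, hD, rfl⟩
  rw [cliqueDomNum, ← hc]
  exact hG.bVec_le_card_of_isDominatingClique hi hD'

open Classical in
/-- The maximal cliques of `G` with at least `i` vertices. -/
noncomputable def maxlCliques (G : SimpleGraph V) (i : ℕ) : Finset (Finset V) :=
  Finset.univ.filter fun M => G.IsMaxlClique M ∧ i ≤ M.card

theorem mem_maxlCliques {M : Finset V} :
    M ∈ G.maxlCliques i ↔ G.IsMaxlClique M ∧ i ≤ M.card := by
  classical
  simp [maxlCliques]

theorem maxlCliques_antitone (G : SimpleGraph V) : Antitone G.maxlCliques := by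
  intro i j hij M hM
  rw [mem_maxlCliques] at hM ⊢
  exact ⟨hM.1, hij.trans hM.2⟩

theorem cliqueDomNum_le_card_maxlCliques (G : SimpleGraph V) (i : ℕ) :
    G.cliqueDomNum i ≤ (G.maxlCliques i).card := by
  classical
  have h : ∀ M : Finset V, ∃ K, i ≤ M.card → K ⊆ M ∧ K.card = i := by
    intro M
    by_cases hM : i ≤ M.card
    · obtain ⟨K, hK⟩ := Finset.exists_subset_card_eq hM
      exact ⟨K, fun _ => hK⟩
    · exact ⟨∅, fun h => absurd h hM⟩
  choose F hF using h
  refine le_trans (Nat.sInf_le ⟨(G.maxlCliques i).image F, ⟨?_, ?_⟩, rfl⟩)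
    Finset.card_image_le
  · intro K hK
    obtain ⟨M, hM, rfl⟩ := Finset.mem_image.1 hK
    rw [mem_maxlCliques] at hM
    obtain ⟨h1, h2⟩ := hF M hM.2
    exact ⟨hM.1.prop.subset (Finset.coe_subset.2 h1), h2⟩
  · intro M hM hi
    exact ⟨F M, Finset.mem_image_of_mem F (mem_maxlCliques.2 ⟨hM, hi⟩), (hF M hi).1⟩

variable [DecidableEq V]

theorem IsMaxlClique.eq_of_kappaTilde_lt {K M N : Finset V} (hM : G.IsMaxlClique M)
    (hN : G.IsMaxlClique N) (hKM : K ⊆ M) (hKN : K ⊆ N) (hK : G.kappaTilde < K.card) :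
    M = N := by
  by_contra hne
  have h1 : (M ∩ N).card ≤ G.kappaTilde :=
    le_csSup G.bddAbove_kappaTilde ⟨M, N, hM, hN, hne, rfl⟩
  have h2 := Finset.card_le_card (Finset.subset_inter hKM hKN)
  omega

/-- Above `κ̃`, sending an `i`-clique to the only maximal clique that contains it is an invariant
function, and its values are all the maximal cliques of size at least `i`. -/
theorem IsChordal.card_maxlCliques_le_bVec (hG : G.IsChordal) (hi : G.kappaTilde < i) :
    ((G.maxlCliques i).card : ℤ) ≤ G.bVec i := by
  have h : ∀ K : Finset V, ∃ M, G.IsClique (K : Set V) → K ⊆ M ∧ G.IsMaxlClique M := by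
    intro K
    by_cases hK : G.IsClique (K : Set V)
    · obtain ⟨M, hM⟩ := hK.exists_isMaxlClique
      exact ⟨M, fun _ => hM⟩
    · exact ⟨∅, fun h => absurd h hK⟩
  choose g hg using h
  have hgM : ∀ K M : Finset V, K.card = i → K ⊆ M → G.IsMaxlClique M → g K = M := by
    intro K M hc hKM hM
    obtain ⟨h1, h2⟩ := hg K (hM.prop.subset (Finset.coe_subset.2 hKM))
    exact h2.eq_of_kappaTilde_lt hM h1 hKM (hc ▸ hi)
  have hinv : G.IsCliqueInvariant Finset.univ i g := by
    intro K hK L hL hKL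
    rw [← Finset.coe_union] at hKL
    obtain ⟨M, hM, hMm⟩ := hKL.exists_isMaxlClique
    rw [hgM K M (mem_cliquesIn.1 hK).1.2 (Finset.subset_union_left.trans hM) hMm,
      hgM L M (mem_cliquesIn.1 hL).1.2 (Finset.subset_union_right.trans hM) hMm]
  rw [← bVecIn_univ]
  refine le_trans (Int.ofNat_le.2 (Finset.card_le_card fun M hM => ?_))
    (hG.card_image_le_bVecIn (by omega) Finset.univ hinv)
  obtain ⟨hMm, hMc⟩ := mem_maxlCliques.1 hM
  obtain ⟨K, hKM, hc⟩ := Finset.exists_subset_card_eq hMc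
  exact Finset.mem_image.2 ⟨K, mem_cliquesIn.2 ⟨⟨Finset.subset_univ _, hc⟩,
    hMm.prop.subset (Finset.coe_subset.2 hKM)⟩, hgM K M hc hKM hMm⟩

theorem IsChordal.bVec_eq_card_maxlCliques (hG : G.IsChordal) (hi : G.kappaTilde < i) :
    G.bVec i = (G.maxlCliques i).card :=
  le_antisymm ((hG.bVec_le_cliqueDomNum (by omega)).trans
    (Int.ofNat_le.2 (G.cliqueDomNum_le_card_maxlCliques i))) (hG.card_maxlCliques_le_bVec hi)

end

end SimpleGraph

theorem mainTheorem2 {V : Type*} [Fintype V] [DecidableEq V] (G : SimpleGraph V)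
    (hG : G.IsChordal) :
    (∀ i : ℕ, 1 ≤ i → i ≤ G.cliqueNum → G.bVec i ≤ (G.cliqueDomNum i : ℤ)) ∧
    (∀ i : ℕ, G.kappaTilde < i → i ≤ G.cliqueNum → G.bVec i = (G.cliqueDomNum i : ℤ)) ∧
    (∀ i j : ℕ, G.kappaTilde < j → j ≤ i → i ≤ G.cliqueNum → G.bVec i ≤ G.bVec j) := by
  refine ⟨fun i hi _ => hG.bVec_le_cliqueDomNum hi, fun i hi _ => ?_, fun i j hj hji _ => ?_⟩
  · refine le_antisymm (hG.bVec_le_cliqueDomNum (by omega)) ?_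
    rw [hG.bVec_eq_card_maxlCliques hi]
    exact Int.ofNat_le.2 (G.cliqueDomNum_le_card_maxlCliques i)
  · rw [hG.bVec_eq_card_maxlCliques (hj.trans_le hji), hG.bVec_eq_card_maxlCliques hj]
    exact Int.ofNat_le.2 (Finset.card_le_card (G.maxlCliques_antitone hji))
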